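/- Let $0\le\Omega<1$, $g\ge 0$ and $\lambda\in\mathbb R$. On $\mathbb R^2$ let $$A_\Omega=-\tfrac12\Delta+\tfrac12|\mathbf x|^2-\Omega L_z,\qquad L_z=i(x_1\partial_2-x_2\partial_1).$$ For $\psi\in L^2(\mathbb R^2;\mathbb C)$ with distributional gradient in $L^2$ let $$\|\psi\|_\Omega^2=\int\bar\psi A_\Omega\psi:=\int_{\mathbb R^2}\Big(\tfrac12|\nabla\psi|^2+\tfrac12|\mathbf x|^2|\psi|^2-\Omega\,\mathrm{Re}(\bar\psi L_z\psi)\Big)\,d\mathbf x\in[0,\infty]$$ (the integrand is pointwise nonnegative), and let $\|\psi\|_\Omega=\infty$ for all other $\psi\in L^2$. Let $H_\Omega=\{\psi\in L^2:\|\psi\|_\Omega<\infty\}$ and $$F(\psi)=\|\psi\|_\Omega^2+\frac g2\int|\psi|^4\,d\mathbf x+\frac12\big(\|\psi\|_2^2-\lambda\big)^2,\qquad \psi\in H_\Omega .$$ Then the set $$\bar U=\{\psi\in L^2:\ \|\psi\|_\Omega^2\le\lambda\|\psi\|_2^2\le\lambda(\lambda-1)\}$$ is compact in $L^2(\mathbb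 R^2;\mathbb C)$. If moreover $\lambda\ge 1$ or $\lambda\le 0$, then every absolute minimizer of $F$ over $H_\Omega$ belongs to $\bar U$. -/

import Mathlib

open MeasureTheory
open scoped SchwartzMap LineDeriv ENNReal

noncomputable section

namespace RotatingTrap

/-- The Euclidean plane. -/
abbrev Plane : Type := EuclideanSpace ℝ (Fin 2)

/-- The complex Hilbert space of (classes of) square integrable functions on the plane. -/
abbrev L2 : Type := Lp ℂ 2 (volume : Measure Plane)

/-- The coordinate direction `i` of the plane. -/
def dir (i : Fin 2) : Plane := EuclideanSpace.single i (1 : ℝ)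

/-- `G 0` and `G 1` are the distributional partial derivatives of `ψ`
(and they are square integrable). -/
def IsGradient (ψ : L2) (G : Fin 2 → L2) : Prop :=
  ∀ i : Fin 2, ∂_{dir i} (ψ : 𝓢'(Plane, ℂ)) = (G i : 𝓢'(Plane, ℂ))

/-- The value `conj u * (L_z ψ)(x)`, where `L_z = i (x₁ ∂₂ - x₂ ∂₁)`, `u = ψ x` and `p i` is the
`i`-th partial derivative of `ψ` at `x`. -/
def angularMomentumDensity (x : Plane) (u : ℂ) (p : Fin 2 → ℂ) : ℂ :=
  (starRingEnd ℂ) u * (Complex.I * ((x 0 : ℂ) * p 1 - (x 1 : ℂ) * p 0))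

/-- The pointwise density of the quadratic form of
`A_Ω = -(1/2) Δ + (1/2) |x|² - Ω L_z`, after one integration by parts in the Laplacian.
The imaginary part of the angular momentum density integrates to zero, as `L_z` is Hermitian. -/
def formDensity (Ω : ℝ) (x : Plane) (u : ℂ) (p : Fin 2 → ℂ) : ℝ :=
  (1 / 2) * (‖p 0‖ ^ 2 + ‖p 1‖ ^ 2) + (1 / 2) * ‖x‖ ^ 2 * ‖u‖ ^ 2
    - Ω * (angularMomentumDensity x u p).re

/-- For `0 ≤ Ω ≤ 1` the density of the form is nonnegative, so that nothing is cut off by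
`ENNReal.ofReal` in the definition of `omegaNormSq`. -/
theorem formDensity_nonneg {Ω : ℝ} (h0 : 0 ≤ Ω) (h1 : Ω ≤ 1) (x : Plane) (u : ℂ)
    (p : Fin 2 → ℂ) : 0 ≤ formDensity Ω x u p := by
  have hx : ‖x‖ ^ 2 = x 0 ^ 2 + x 1 ^ 2 := by
    rw [EuclideanSpace.norm_sq_eq]
    simp
  have hL : 2 * (angularMomentumDensity x u p).re
      ≤ ‖p 0‖ ^ 2 + ‖p 1‖ ^ 2 + ‖x‖ ^ 2 * ‖u‖ ^ 2 := by
    simp only [angularMomentumDensity, hx, Complex.sq_norm, Complex.normSq_apply, Complex.mul_re,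
      Complex.mul_im, Complex.sub_re, Complex.sub_im, Complex.conj_re, Complex.conj_im,
      Complex.I_re, Complex.I_im, Complex.ofReal_re, Complex.ofReal_im]
    nlinarith [sq_nonneg ((p 1).im + x 0 * u.re), sq_nonneg ((p 1).re - x 0 * u.im),
      sq_nonneg ((p 0).im - x 1 * u.re), sq_nonneg ((p 0).re + x 1 * u.im)]
  have hR : 0 ≤ ‖p 0‖ ^ 2 + ‖p 1‖ ^ 2 + ‖x‖ ^ 2 * ‖u‖ ^ 2 := by positivity
  unfold formDensity
  nlinarith

/-- `‖ψ‖_Ω² = ∫ conj ψ A_Ω ψ`, the extended quadratic form of `A_Ω`. The distributional gradient is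
unique if it exists; the value is `∞` if `ψ` has no square integrable gradient. -/
def omegaNormSq (Ω : ℝ) (ψ : L2) : ℝ≥0∞ :=
  ⨅ (G : Fin 2 → L2) (_ : IsGradient ψ G),
    ∫⁻ x : Plane, ENNReal.ofReal (formDensity Ω x (ψ x) (fun i => G i x))

/-- The space `H_Ω` of the functions with finite `‖ψ‖_Ω`. -/
def HOmega (Ω : ℝ) : Set L2 := {ψ | omegaNormSq Ω ψ < ∞}

/-- The free energy
`F(ψ) = ∫ conj ψ A_Ω ψ + ∫ (g/2) |ψ|⁴ + (1/2) (∫ |ψ|² - lam)²`. -/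
def freeEnergy (Ω g lam : ℝ) (ψ : L2) : ℝ≥0∞ :=
  omegaNormSq Ω ψ + ENNReal.ofReal (g / 2) * (∫⁻ x : Plane, ‖ψ x‖ₑ ^ 4)
    + ENNReal.ofReal ((1 / 2) * (‖ψ‖ ^ 2 - lam) ^ 2)

/-- An absolute minimum of the free energy over its domain `H_Ω`. -/
def IsAbsoluteMinimizer (Ω g lam : ℝ) (ψ : L2) : Prop :=
  ψ ∈ HOmega Ω ∧ ∀ φ ∈ HOmega Ω, freeEnergy Ω g lam ψ ≤ freeEnergy Ω g lam φ

/-- The set of all `ψ` in `L²` with `‖ψ‖_Ω² ≤ lam ‖ψ‖₂² ≤ lam (lam - 1)`. -/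
def UBar (Ω lam : ℝ) : Set L2 :=
  {ψ | omegaNormSq Ω ψ < ∞ ∧ (omegaNormSq Ω ψ).toReal ≤ lam * ‖ψ‖ ^ 2 ∧
    lam * ‖ψ‖ ^ 2 ≤ lam * (lam - 1)}

end RotatingTrap

end

noncomputable section

open Filter
open scoped Topology ContDiff Convolution InnerProductSpace

namespace RotatingTrap

/-! Write `n = ‖ψ‖ ^ 2`, and let `G` and `X` be the weak gradient of `ψ` and its products with the
coordinates.

Spectral bound. The commutation relations `[∂_i, x_i] = 1` and `[∂_0, ∂_1] = 0` give `n ≤ ‖ψ‖_Ω²`: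
the form is affine in `Ω`, and at both `Ω = 0` and `Ω = 1` it is `n` plus squares
(`norm_sq_le_energy`). Only first derivatives of `ψ` are square integrable, so the relations are
proved for translations and passed to the weak limit of difference quotients.

Minimizers. Comparing a minimizer `ψ` with `t • ψ` for `t` slightly below `1` gives `‖ψ‖_Ω² ≤ lam *
n - n ^ 2` (`IsAbsoluteMinimizer.energy_le`). Together with the spectral bound this forces `n = 0`
or `n ≤ lam - 1`.

Compactness. For `Ω < 1` the form dominates `(1 - Ω) / 2` times the squared norms of `G` and `X`, so
a sequence in `UBar` has a subsequence along which `ψ`, `G` and `X` all converge weakly. Convergence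
of `ψ` is strong by a Kolmogorov–Riesz argument (`tendsto_zero_of_weak`): gradients control
translations, moments prevent escape to infinity, and local means converge pointwise. Hence `‖ψ‖`
passes to the limit, and the energy, a sum of squares, is weakly lower semicontinuous. -/

/-! ### Translations -/

/-- The translation `f ↦ f (· + h)` of `L²`. -/
def translate (h : Plane) : L2 →ₗᵢ[ℂ] L2 :=
  Lp.compMeasurePreservingₗᵢ ℂ (· + h) (measurePreserving_add_right volume h)

theorem coeFn_translate (h : Plane) (f : L2) : translate h f =ᵐ[volume] fun x => f (x + h) :=
  Lp.coeFn_compMeasurePreserving f (measurePreserving_add_right volume h)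

theorem ae_comp_add {p : Plane → Prop} (hp : ∀ᵐ x, p x) (h : Plane) : ∀ᵐ x, p (x + h) :=
  (measurePreserving_add_right volume h).quasiMeasurePreserving.ae hp

theorem translate_translate (a b : Plane) (f : L2) :
    translate a (translate b f) = translate (a + b) f := by
  refine Lp.ext ?_
  filter_upwards [coeFn_translate a (translate b f), ae_comp_add (coeFn_translate b f) a,
    coeFn_translate (a + b) f] with x h1 h2 h3
  rw [h1, h2, h3, add_assoc]

theorem translate_zero (f : L2) : translate 0 f = f := by
  refine Lp.ext ?_
  filter_upwards [coeFn_translate 0 f] with x h1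
  rw [h1, add_zero]

theorem inner_translate_left (h : Plane) (f g : L2) :
    ⟪translate h f, g⟫_ℂ = ⟪f, translate (-h) g⟫_ℂ := by
  have : g = translate h (translate (-h) g) := by
    rw [translate_translate, add_neg_cancel, translate_zero]
  conv_lhs => rw [this]
  exact (translate h).inner_map_map _ _

/-! ### Weak derivatives as generators of translations -/

theorem IsGradient.integral_mul_eq {ψ : L2} {G : Fin 2 → L2} (hG : IsGradient ψ G) (i : Fin 2)
    (S : 𝓢(Plane, ℂ)) : ∫ x, S x * G i x = - ∫ x, (∂_{dir i} S) x * ψ x := by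
  have h := congrArg (fun T : 𝓢'(Plane, ℂ) => T S) (hG i)
  simp only [TemperedDistribution.lineDerivOp_apply_apply, Lp.toTemperedDistribution_apply,
    smul_eq_mul] at h
  rw [← h, ← integral_neg]
  simp

theorem IsGradient.of_integral_mul_eq {ψ : L2} {G : Fin 2 → L2}
    (h : ∀ (i : Fin 2) (S : 𝓢(Plane, ℂ)),
      ∫ x, S x * G i x = - ∫ x, (∂_{dir i} S) x * ψ x) : IsGradient ψ G := by
  intro i
  ext S
  simp only [TemperedDistribution.lineDerivOp_apply_apply, Lp.toTemperedDistribution_apply,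
    smul_eq_mul, h i S, ← integral_neg]
  simp

/-- As a function of the shift, the pairing is the convolution of `ψ` with the reflected conjugate
of `φ`. The derivative falls on that smooth factor, and the definition of the weak gradient moves it
back to `ψ`. -/
theorem hasDerivAt_inner_translate {ψ : L2} {G : Fin 2 → L2} (hG : IsGradient ψ G) (i : Fin 2)
    {Φ : L2} {φ : Plane → ℂ} (hΦ : Φ =ᵐ[volume] φ) (hc : HasCompactSupport φ)
    (hs : ContDiff ℝ ∞ φ) (t : ℝ) :
    HasDerivAt (fun s : ℝ => ⟪Φ, translate (s • dir i) ψ⟫_ℂ)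
      ⟪Φ, translate (t • dir i) (G i)⟫_ℂ t := by
  set g : Plane → ℂ := fun y => (starRingEnd ℂ) (φ (-y)) with hg
  have hgs : ContDiff ℝ ∞ g := by
    have : ContDiff ℝ ∞ fun y => φ (-y) := hs.comp contDiff_neg
    exact Complex.conjCLE.contDiff.comp this
  have hgc : HasCompactSupport g :=
    (hc.comp_homeomorph (Homeomorph.neg Plane)).comp_left (map_zero _)
  have key : ∀ (h : Plane) (f : L2), ⟪Φ, translate h f⟫_ℂ = ∫ x, f x * g (h - x) := by
    intro h f
    rw [L2.inner_def]
    rw [← integral_add_right_eq_self (fun x => f x * g (h - x)) h]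
    refine integral_congr_ae ?_
    filter_upwards [hΦ, coeFn_translate h f] with x h1 h2
    simp [h1, h2, hg, RCLike.inner_apply]
  have hloc : LocallyIntegrable (ψ : Plane → ℂ) volume :=
    (Lp.memLp ψ).locallyIntegrable (by norm_num)
  have hF := hgc.hasFDerivAt_convolution_right (ContinuousLinearMap.mul ℝ ℂ) hloc
    (hgs.of_le (by simp)) (t • dir i)
  have hline : HasDerivAt (fun s : ℝ => s • dir i) (dir i) t := by
    simpa using (hasDerivAt_id t).smul_const (dir i)
  have hD := hF.comp_hasDerivAt t hline
  rw [convolution_precompR_apply (ContinuousLinearMap.mul ℝ ℂ) hloc (hgc.fderiv ℝ)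
    (hgs.continuous_fderiv (by simp))] at hD
  have e1 : (fun s : ℝ => ⟪Φ, translate (s • dir i) ψ⟫_ℂ)
      = ((ψ : Plane → ℂ) ⋆[ContinuousLinearMap.mul ℝ ℂ, volume] g) ∘ fun s : ℝ => s • dir i := by
    funext s
    rw [key]
    rfl
  rw [e1]
  refine hD.congr_deriv ?_
  rw [key]
  symm
  set h := t • dir i
  have hc' : HasCompactSupport fun x => g (h - x) :=
    hgc.comp_homeomorph (Homeomorph.subLeft h)
  have hs' : ContDiff ℝ ∞ fun x => g (h - x) := hgs.comp (contDiff_const.sub contDiff_id)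
  have hI := hG.integral_mul_eq i (hc'.toSchwartzMap hs')
  have hder : ∀ x, (∂_{dir i} (hc'.toSchwartzMap hs')) x = -(fderiv ℝ g (h - x)) (dir i) := by
    intro x
    rw [SchwartzMap.lineDerivOp_apply_eq_fderiv]
    have h1 : HasFDerivAt g (fderiv ℝ g (h - x)) (h - x) :=
      (hgs.differentiable (by simp) _).hasFDerivAt
    have h2 : HasFDerivAt (fun y : Plane => h - y) (-ContinuousLinearMap.id ℝ Plane) x :=
      (hasFDerivAt_id x).const_sub h
    have h3 := h1.comp x h2
    have h4 : fderiv ℝ (fun y => g (h - y)) x = _ := h3.fderiv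
    change fderiv ℝ (fun y => g (h - y)) x (dir i) = _
    rw [h4]
    simp
  simp only [hder] at hI
  change ∫ x, G i x * g (h - x) = ∫ x, ψ x * (fderiv ℝ g (h - x)) (dir i)
  rw [show ∫ x, G i x * g (h - x) = ∫ x, (hc'.toSchwartzMap hs') x * G i x from
    integral_congr_ae (.of_forall fun x => mul_comm _ _), hI, ← integral_neg]
  refine integral_congr_ae (.of_forall fun x => ?_)
  simp [mul_comm]

theorem norm_le_of_dense_inner {E : Type*} [NormedAddCommGroup E] [InnerProductSpace ℂ E]
    {s : Set E} (hs : Dense s) {v : E} {C : ℝ} (hC : 0 ≤ C)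
    (h : ∀ u ∈ s, ‖⟪u, v⟫_ℂ‖ ≤ C * ‖u‖) : ‖v‖ ≤ C := by
  have hcl : IsClosed {u : E | ‖⟪u, v⟫_ℂ‖ ≤ C * ‖u‖} :=
    isClosed_le (by fun_prop) (by fun_prop)
  have hv : ‖⟪v, v⟫_ℂ‖ ≤ C * ‖v‖ := hcl.closure_subset_iff.2 h (hs v)
  rw [inner_self_eq_norm_sq_to_K, norm_pow, RCLike.norm_ofReal, abs_norm] at hv
  rcases (norm_nonneg v).eq_or_lt with h0 | h0
  · rwa [← h0]
  · nlinarith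

theorem tendsto_inner_of_dense {E ι : Type*} [NormedAddCommGroup E] [InnerProductSpace ℂ E]
    {s : Set E} (hs : Dense s) {l : Filter ι} {u : ι → E} {v : E} {C : ℝ}
    (hC : ∀ i, ‖u i‖ ≤ C) (h : ∀ w ∈ s, Tendsto (fun i => ⟪w, u i⟫_ℂ) l (𝓝 ⟪w, v⟫_ℂ)) (w : E) :
    Tendsto (fun i => ⟪w, u i⟫_ℂ) l (𝓝 ⟪w, v⟫_ℂ) := by
  rw [Metric.tendsto_nhds]
  intro ε hε
  have hpos : 0 < |C| + ‖v‖ + 1 := by positivity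
  obtain ⟨w', hw', hd⟩ := hs.exists_dist_lt w (show 0 < ε / 2 / (|C| + ‖v‖ + 1) by positivity)
  filter_upwards [(Metric.tendsto_nhds.1 (h w' hw')) (ε / 2) (by positivity)] with i hi
  rw [dist_eq_norm, ← inner_sub_right] at hi ⊢
  have e : ⟪w, u i - v⟫_ℂ = ⟪w - w', u i - v⟫_ℂ + ⟪w', u i - v⟫_ℂ := by
    rw [← inner_add_left, sub_add_cancel]
  have h1 : ‖⟪w - w', u i - v⟫_ℂ‖ ≤ ‖w - w'‖ * (|C| + ‖v‖ + 1) := by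
    refine (norm_inner_le_norm _ _).trans (mul_le_mul_of_nonneg_left ?_ (norm_nonneg _))
    have := norm_sub_le (u i) v
    linarith [hC i, le_abs_self C]
  rw [dist_eq_norm, lt_div_iff₀ hpos] at hd
  rw [e]
  linarith [norm_add_le ⟪w - w', u i - v⟫_ℂ ⟪w', u i - v⟫_ℂ]

/-- The mean value inequality applied to pairings with a dense set of test functions. -/
theorem norm_translate_sub_le {ψ : L2} {G : Fin 2 → L2} (hG : IsGradient ψ G) (i : Fin 2) (t : ℝ) :
    ‖translate (t • dir i) ψ - ψ‖ ≤ ‖G i‖ * |t| := by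
  refine norm_le_of_dense_inner (Lp.dense_hasCompactSupport_contDiff (by norm_num)) (by positivity) ?_
  rintro Φ ⟨φ, hΦ, hc, hs⟩
  have hb := convex_univ.norm_image_sub_le_of_norm_hasDerivWithin_le
    (f := fun s : ℝ => ⟪Φ, translate (s • dir i) ψ⟫_ℂ) (C := ‖Φ‖ * ‖G i‖) (x := 0) (y := t)
    (fun s _ => (hasDerivAt_inner_translate hG i hΦ hc hs s).hasDerivWithinAt)
    (fun s _ => by
      refine (norm_inner_le_norm _ _).trans_eq ?_
      rw [LinearIsometry.norm_map]) trivial trivial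
  simp only [zero_smul, translate_zero, ← inner_sub_right, sub_zero, Real.norm_eq_abs] at hb
  linarith

/-- Difference quotients converge weakly to the weak derivative. -/
theorem tendsto_inner_differenceQuotient {ψ : L2} {G : Fin 2 → L2} (hG : IsGradient ψ G)
    (i : Fin 2) (Φ : L2) :
    Tendsto (fun t : ℝ => ⟪Φ, (t : ℂ)⁻¹ • (translate (t • dir i) ψ - ψ)⟫_ℂ) (𝓝[≠] 0)
      (𝓝 ⟪Φ, G i⟫_ℂ) := by
  refine tendsto_inner_of_dense (C := ‖G i‖)
    (Lp.dense_hasCompactSupport_contDiff (F := ℂ) (by norm_num)) ?_ ?_ Φ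
  · intro t
    rw [norm_smul, norm_inv, Complex.norm_real, Real.norm_eq_abs]
    rcases eq_or_ne t 0 with rfl | ht
    · simp
    · rw [inv_mul_le_iff₀ (abs_pos.2 ht), mul_comm]
      exact norm_translate_sub_le hG i t
  · rintro Φ ⟨φ, hΦ, hc, hs⟩
    have h := hasDerivAt_inner_translate hG i hΦ hc hs 0
    rw [zero_smul, translate_zero] at h
    refine (hasDerivAt_iff_tendsto_slope_zero.1 h).congr fun t => ?_
    rw [zero_add, zero_smul, translate_zero, inner_smul_right, inner_sub_right, ← Complex.ofReal_inv,
      Complex.real_smul]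

/-! ### Commutation relations in weak form -/

/-- `X 0` and `X 1` are the products of `ψ` with the coordinates (and they are square
integrable). -/
def IsPosition (ψ : L2) (X : Fin 2 → L2) : Prop :=
  ∀ i : Fin 2, X i =ᵐ[volume] fun x => (x i : ℂ) * ψ x

/-- Symmetric differences of `ψ`, without the factor `(2 * t)⁻¹`. -/
def symmDifference (h : Plane) (ψ : L2) : L2 := translate h ψ - translate (-h) ψ

/-- Symmetric differences, unlike one-sided ones, are exactly skew-adjoint, as `∂_i` is. -/
theorem inner_symmDifference_left (h : Plane) (f g : L2) :
    ⟪symmDifference h f, g⟫_ℂ = -⟪f, symmDifference h g⟫_ℂ := by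
  simp only [symmDifference, inner_sub_left, inner_sub_right, inner_translate_left, neg_neg]
  ring

theorem symmDifference_comm (a b : Plane) (f : L2) :
    symmDifference a (symmDifference b f) = symmDifference b (symmDifference a f) := by
  simp only [symmDifference, map_sub, translate_translate]
  rw [add_comm b a, add_comm (-b) a, add_comm b (-a), add_comm (-b) (-a)]
  abel

theorem tendsto_inner_symmDifference {ψ : L2} {G : Fin 2 → L2} (hG : IsGradient ψ G)
    (i : Fin 2) (Φ : L2) :
    Tendsto (fun t : ℝ => (t : ℂ)⁻¹ * ⟪Φ, symmDifference (t • dir i) ψ⟫_ℂ) (𝓝[≠] 0)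
      (𝓝 (2 * ⟪Φ, G i⟫_ℂ)) := by
  have h1 := tendsto_inner_differenceQuotient hG i Φ
  have hneg : Tendsto (fun t : ℝ => -t) (𝓝[≠] 0) (𝓝[≠] 0) := by
    refine tendsto_nhdsWithin_iff.2 ⟨?_, ?_⟩
    · have : Tendsto (fun t : ℝ => -t) (𝓝 0) (𝓝 (-0)) := tendsto_id.neg
      rw [neg_zero] at this
      exact this.mono_left nhdsWithin_le_nhds
    · filter_upwards [self_mem_nhdsWithin] with t ht
      simpa using ht
  have h2 := h1.add (h1.comp hneg)
  rw [← two_mul] at h2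
  refine h2.congr fun t => ?_
  simp only [Function.comp, symmDifference, inner_smul_right, inner_sub_right, Complex.ofReal_neg,
    neg_smul, inv_neg, inner_neg_right]
  ring

theorem tendsto_translate_zero {ψ : L2} {G : Fin 2 → L2} (hG : IsGradient ψ G) (i : Fin 2) :
    Tendsto (fun t : ℝ => translate (t • dir i) ψ) (𝓝 0) (𝓝 ψ) := by
  rw [tendsto_iff_norm_sub_tendsto_zero]
  refine squeeze_zero (fun _ => norm_nonneg _) (norm_translate_sub_le hG i) ?_
  have : Tendsto (fun t : ℝ => ‖G i‖ * |t|) (𝓝 0) (𝓝 (‖G i‖ * |0|)) :=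
    (continuous_const.mul continuous_abs).tendsto 0
  simpa using this

/-- The discrete form of `[∂_i, x_i] = 1`: a shift by `t` along axis `i` turns `x i` into `x i + t`.
Being exact for each `t`, it needs no derivative of `X i`. -/
theorem inner_position_symmDifference {ψ : L2} {X : Fin 2 → L2} (hX : IsPosition ψ X)
    (i : Fin 2) (t : ℝ) :
    (⟪X i, symmDifference (t • dir i) ψ⟫_ℂ).re = -t * (⟪ψ, translate (t • dir i) ψ⟫_ℂ).re := by
  set h := t • dir i with hh
  have hi : h i = t := by simp [hh, dir]
  have key : ⟪translate h (X i) - (t : ℂ) • translate h ψ, ψ⟫_ℂ = ⟪translate h ψ, X i⟫_ℂ := by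
    rw [L2.inner_def, L2.inner_def]
    refine integral_congr_ae ?_
    filter_upwards [hX i, ae_comp_add (hX i) h, coeFn_translate h (X i), coeFn_translate h ψ,
      Lp.coeFn_sub (translate h (X i)) ((t : ℂ) • translate h ψ),
      Lp.coeFn_smul (t : ℂ) (translate h ψ)] with x h1 h2 h3 h4 h5 h6
    rw [h5, Pi.sub_apply, h6, Pi.smul_apply, h3, h2, h4, h1]
    simp only [RCLike.inner_apply, smul_eq_mul, PiLp.add_apply, hi, map_sub, map_mul,
      Complex.conj_ofReal, Complex.ofReal_add, map_add]
    ring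
  rw [symmDifference, inner_sub_right, ← inner_translate_left]
  rw [inner_sub_left, inner_smul_left, Complex.conj_ofReal] at key
  have e1 : (⟪X i, translate h ψ⟫_ℂ).re = (⟪translate h ψ, X i⟫_ℂ).re :=
    inner_re_symm (𝕜 := ℂ) _ _
  have e2 : (⟪translate h ψ, ψ⟫_ℂ).re = (⟪ψ, translate h ψ⟫_ℂ).re :=
    inner_re_symm (𝕜 := ℂ) _ _
  have e3 := congrArg Complex.re key
  rw [Complex.sub_re, Complex.re_ofReal_mul] at e3
  rw [Complex.sub_re, e1, ← e3, e2]
  ring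

theorem re_inner_position_gradient {ψ : L2} {G X : Fin 2 → L2} (hG : IsGradient ψ G)
    (hX : IsPosition ψ X) (i : Fin 2) : (⟪X i, G i⟫_ℂ).re = -(‖ψ‖ ^ 2 / 2) := by
  have h1 := (Complex.continuous_re.tendsto _).comp (tendsto_inner_symmDifference hG i (X i))
  have h2 : Tendsto (fun t : ℝ => -(⟪ψ, translate (t • dir i) ψ⟫_ℂ).re) (𝓝[≠] 0)
      (𝓝 (-(⟪ψ, ψ⟫_ℂ).re)) :=
    ((Complex.continuous_re.tendsto _).comp ((tendsto_const_nhds.inner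
      (tendsto_translate_zero hG i)).mono_left nhdsWithin_le_nhds)).neg
  have h3 := tendsto_nhds_unique (h1.congr' ?_) h2
  · have e : (⟪ψ, ψ⟫_ℂ).re = ‖ψ‖ ^ 2 := inner_self_eq_norm_sq (𝕜 := ℂ) ψ
    rw [e] at h3
    have : (2 * ⟪X i, G i⟫_ℂ).re = 2 * (⟪X i, G i⟫_ℂ).re := by simp
    linarith
  · filter_upwards [self_mem_nhdsWithin] with t ht
    have ht : t ≠ 0 := ht
    rw [Function.comp, ← Complex.ofReal_inv, Complex.re_ofReal_mul,
      inner_position_symmDifference hX]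
    field_simp

theorem im_inner_symmDifference (a b : Plane) (f : L2) :
    (⟪symmDifference a f, symmDifference b f⟫_ℂ).im = 0 := by
  have h : ⟪symmDifference a f, symmDifference b f⟫_ℂ
      = ⟪symmDifference b f, symmDifference a f⟫_ℂ := by
    rw [inner_symmDifference_left, inner_symmDifference_left, symmDifference_comm]
  have h2 := congrArg Complex.im h
  rw [← inner_conj_symm (symmDifference b f), Complex.conj_im] at h2
  linarith

/-- The weak form of `[∂_i, ∂_j] = 0`. The two slots are sent to the limit one after the other,
since a pairing of two weakly convergent families need not converge to the pairing of the limits. -/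
theorem im_inner_gradient {ψ : L2} {G : Fin 2 → L2} (hG : IsGradient ψ G) (i j : Fin 2) :
    (⟪G i, G j⟫_ℂ).im = 0 := by
  have h1 : ∀ a, (⟪symmDifference a ψ, G j⟫_ℂ).im = 0 := by
    intro a
    have h := (Complex.continuous_im.tendsto _).comp
      (tendsto_inner_symmDifference hG j (symmDifference a ψ))
    have h' := tendsto_nhds_unique (h.congr fun t => ?_) (tendsto_const_nhds (x := (0 : ℝ)))
    · simpa using h'
    · rw [Function.comp, ← Complex.ofReal_inv, Complex.im_ofReal_mul, im_inner_symmDifference,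
        mul_zero]
  have h := (Complex.continuous_im.tendsto _).comp (tendsto_inner_symmDifference hG i (G j))
  have h' := tendsto_nhds_unique (h.congr fun t => ?_) (tendsto_const_nhds (x := (0 : ℝ)))
  · rw [← inner_conj_symm, Complex.conj_im]
    simpa using h'
  · rw [Function.comp, ← Complex.ofReal_inv, Complex.im_ofReal_mul, ← inner_conj_symm,
      Complex.conj_im, h1, neg_zero, mul_zero]

theorem im_inner_position {ψ : L2} {X : Fin 2 → L2} (hX : IsPosition ψ X) (i j : Fin 2) :
    (⟪X i, X j⟫_ℂ).im = 0 := by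
  have h : ⟪X i, X j⟫_ℂ = ⟪X j, X i⟫_ℂ := by
    rw [L2.inner_def, L2.inner_def]
    refine integral_congr_ae ?_
    filter_upwards [hX i, hX j] with x h1 h2
    rw [h1, h2]
    simp only [RCLike.inner_apply, map_mul, Complex.conj_ofReal]
    ring
  have h2 := congrArg Complex.im h
  rw [← inner_conj_symm (X j), Complex.conj_im] at h2
  linarith

/-! ### The form in terms of gradient and position -/

/-- The value of the quadratic form of `A_Ω` at a function with gradient `G` and products `X` with
the coordinates. -/
def energy (Ω : ℝ) (G X : Fin 2 → L2) : ℝ :=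
  (1 / 2) * (‖G 0‖ ^ 2 + ‖G 1‖ ^ 2 + ‖X 0‖ ^ 2 + ‖X 1‖ ^ 2)
    + Ω * ((⟪X 0, G 1⟫_ℂ).im - (⟪X 1, G 0⟫_ℂ).im)

theorem norm_add_sq_complex {E : Type*} [NormedAddCommGroup E] [InnerProductSpace ℂ E] (x y : E) :
    ‖x + y‖ ^ 2 = ‖x‖ ^ 2 + 2 * (⟪x, y⟫_ℂ).re + ‖y‖ ^ 2 :=
  norm_add_sq (𝕜 := ℂ) x y

theorem norm_add_I_smul_sq {E : Type*} [NormedAddCommGroup E] [InnerProductSpace ℂ E] (x y : E)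
    (r : ℝ) : ‖x + (r * Complex.I : ℂ) • y‖ ^ 2
      = ‖x‖ ^ 2 - 2 * r * (⟪x, y⟫_ℂ).im + r ^ 2 * ‖y‖ ^ 2 := by
  rw [norm_add_sq_complex, inner_smul_right, norm_smul, mul_assoc, Complex.re_ofReal_mul,
    Complex.I_mul_re, norm_mul, Complex.norm_real, Complex.norm_I, mul_one, mul_pow,
    Real.norm_eq_abs, sq_abs]
  ring

theorem im_inner_symm {E : Type*} [NormedAddCommGroup E] [InnerProductSpace ℂ E] (x y : E) :
    (⟪x, y⟫_ℂ).im = -(⟪y, x⟫_ℂ).im := by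
  rw [← inner_conj_symm, Complex.conj_im]

/-- The rotation acts as a magnetic potential, leaving a trap of strength `1 - Ω ^ 2`. For `Ω ≤ 1`
every coefficient is nonnegative, which weak lower semicontinuity requires. -/
theorem energy_eq_sum_sq (Ω : ℝ) (G X : Fin 2 → L2) :
    energy Ω G X = (1 / 2) * (‖G 0 + ((-Ω : ℝ) * Complex.I : ℂ) • X 1‖ ^ 2
      + ‖G 1 + ((Ω : ℝ) * Complex.I : ℂ) • X 0‖ ^ 2
      + (1 - Ω ^ 2) * (‖X 0‖ ^ 2 + ‖X 1‖ ^ 2)) := by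
  rw [norm_add_I_smul_sq, norm_add_I_smul_sq, energy, im_inner_symm (X 0), im_inner_symm (X 1)]
  ring

/-- The ground state energy of `A_Ω` is at least `1`. -/
theorem norm_sq_le_energy {Ω : ℝ} (h0 : 0 ≤ Ω) (h1 : Ω ≤ 1) {ψ : L2} {G X : Fin 2 → L2}
    (hG : IsGradient ψ G) (hX : IsPosition ψ X) : ‖ψ‖ ^ 2 ≤ energy Ω G X := by
  have c0 := re_inner_position_gradient hG hX 0
  have c1 := re_inner_position_gradient hG hX 1
  -- `energy 0 G X - ‖ψ‖ ^ 2` is half the sum of the `‖X i + G i‖ ^ 2`.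
  have hE0 : ‖ψ‖ ^ 2 ≤ energy 0 G X := by
    have e0 := norm_add_sq_complex (X 0) (G 0)
    have e1 := norm_add_sq_complex (X 1) (G 1)
    simp only [energy]
    nlinarith [sq_nonneg ‖X 0 + G 0‖, sq_nonneg ‖X 1 + G 1‖]
  -- Twice `energy 1 G X - ‖ψ‖ ^ 2` is `‖(X 0 + G 0) - I • (X 1 + G 1)‖ ^ 2`; the commutation
  -- relations remove the other cross terms.
  have hE1 : ‖ψ‖ ^ 2 ≤ energy 1 G X := by
    have e := norm_add_I_smul_sq (X 0 + G 0) (X 1 + G 1) (-1)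
    rw [norm_add_sq_complex (X 0), norm_add_sq_complex (X 1), inner_add_left, inner_add_right,
      inner_add_right, Complex.add_im, Complex.add_im, Complex.add_im, im_inner_gradient hG,
      im_inner_position hX, im_inner_symm (G 0)] at e
    simp only [energy]
    have := sq_nonneg ‖X 0 + G 0 + ((-1 : ℝ) * Complex.I : ℂ) • (X 1 + G 1)‖
    rw [e] at this
    linarith
  have : energy Ω G X = (1 - Ω) * energy 0 G X + Ω * energy 1 G X := by
    simp only [energy]
    ring
  rw [this]
  nlinarith

theorem plane_norm_sq (x : Plane) : ‖x‖ ^ 2 = x 0 ^ 2 + x 1 ^ 2 := by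
  rw [EuclideanSpace.norm_sq_eq]
  simp

theorem integrable_norm_sq (f : L2) : Integrable (fun x => ‖f x‖ ^ 2) volume :=
  (Lp.memLp f).integrable_norm_pow (by norm_num)

theorem integral_norm_sq (f : L2) : ∫ x, ‖f x‖ ^ 2 = ‖f‖ ^ 2 := by
  have h := inner_self_eq_norm_sq (𝕜 := ℂ) f
  rw [L2.inner_def, ← integral_re (L2.integrable_inner f f)] at h
  rw [← h]
  exact integral_congr_ae (.of_forall fun x => (inner_self_eq_norm_sq (𝕜 := ℂ) (f x)).symm)

theorem formDensity_ae_eq (Ω : ℝ) {ψ : L2} (G : Fin 2 → L2) {X : Fin 2 → L2}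
    (hX : IsPosition ψ X) :
    (fun x => formDensity Ω x (ψ x) fun i => G i x) =ᵐ[volume] fun x =>
      (1 / 2) * (‖G 0 x‖ ^ 2 + ‖G 1 x‖ ^ 2 + ‖X 0 x‖ ^ 2 + ‖X 1 x‖ ^ 2)
        + Ω * ((⟪X 0 x, G 1 x⟫_ℂ).im - (⟪X 1 x, G 0 x⟫_ℂ).im) := by
  filter_upwards [hX 0, hX 1] with x h0 h1
  simp only [formDensity, angularMomentumDensity, h0, h1, plane_norm_sq, norm_mul, mul_pow,
    Complex.norm_real, Real.norm_eq_abs, sq_abs, RCLike.inner_apply, map_mul, Complex.conj_ofReal,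
    Complex.mul_re, Complex.mul_im, Complex.sub_re, Complex.sub_im, Complex.conj_re,
    Complex.conj_im, Complex.I_re, Complex.I_im, Complex.ofReal_re, Complex.ofReal_im]
  ring

theorem lintegral_formDensity {Ω : ℝ} (h0 : 0 ≤ Ω) (h1 : Ω ≤ 1) {ψ : L2} (G : Fin 2 → L2)
    {X : Fin 2 → L2} (hX : IsPosition ψ X) :
    ∫⁻ x, ENNReal.ofReal (formDensity Ω x (ψ x) fun i => G i x)
      = ENNReal.ofReal (energy Ω G X) := by
  have hae := formDensity_ae_eq Ω G hX
  have i1 : Integrable (fun x => (1 / 2 : ℝ) *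
      (‖G 0 x‖ ^ 2 + ‖G 1 x‖ ^ 2 + ‖X 0 x‖ ^ 2 + ‖X 1 x‖ ^ 2)) volume :=
    ((((integrable_norm_sq _).add (integrable_norm_sq _)).add (integrable_norm_sq _)).add
      (integrable_norm_sq _)).const_mul _
  have im_int : ∀ f g : L2, Integrable (fun x => (⟪f x, g x⟫_ℂ).im) volume :=
    fun f g => (L2.integrable_inner (𝕜 := ℂ) f g).im
  have im_eq : ∀ f g : L2, ∫ x, (⟪f x, g x⟫_ℂ).im = (⟪f, g⟫_ℂ).im := by
    intro f g
    rw [L2.inner_def]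
    exact integral_im (𝕜 := ℂ) (L2.integrable_inner f g)
  have i2 : Integrable (fun x => Ω * ((⟪X 0 x, G 1 x⟫_ℂ).im - (⟪X 1 x, G 0 x⟫_ℂ).im)) volume :=
    ((im_int _ _).sub (im_int _ _)).const_mul _
  rw [← ofReal_integral_eq_lintegral_ofReal ((i1.add i2).congr hae.symm)
    (.of_forall fun x => formDensity_nonneg h0 h1 _ _ _), integral_congr_ae hae,
    integral_add i1 i2, integral_const_mul, integral_const_mul, integral_sub (im_int _ _) (im_int _ _),
    im_eq, im_eq, integral_add, integral_add, integral_add]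
  · simp only [integral_norm_sq, energy]
  all_goals first
    | exact integrable_norm_sq _
    | exact (integrable_norm_sq _).add (integrable_norm_sq _)
    | exact ((integrable_norm_sq _).add (integrable_norm_sq _)).add (integrable_norm_sq _)

theorem IsGradient.unique {ψ : L2} {G G' : Fin 2 → L2} (hG : IsGradient ψ G)
    (hG' : IsGradient ψ G') : G = G' := by
  funext i
  exact ext_inner_left ℂ fun Φ => tendsto_nhds_unique (tendsto_inner_differenceQuotient hG i Φ)
    (tendsto_inner_differenceQuotient hG' i Φ)

theorem omegaNormSq_eq {Ω : ℝ} (h0 : 0 ≤ Ω) (h1 : Ω ≤ 1) {ψ : L2} {G X : Fin 2 → L2}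
    (hG : IsGradient ψ G) (hX : IsPosition ψ X) :
    omegaNormSq Ω ψ = ENNReal.ofReal (energy Ω G X) := by
  rw [← lintegral_formDensity h0 h1 G hX]
  refine le_antisymm (iInf₂_le G hG) (le_iInf₂ fun G' hG' => ?_)
  rw [hG.unique hG']

theorem energy_nonneg {Ω : ℝ} (h0 : 0 ≤ Ω) (h1 : Ω ≤ 1) {ψ : L2} {G X : Fin 2 → L2}
    (hG : IsGradient ψ G) (hX : IsPosition ψ X) : 0 ≤ energy Ω G X :=
  (sq_nonneg _).trans (norm_sq_le_energy h0 h1 hG hX)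

/-- The density is affine in `Ω` and nonnegative at `Ω = 1`. A pointwise bound is needed because it
serves to show that `x i * ψ` is square integrable at all. -/
theorem le_formDensity {Ω : ℝ} (h0 : 0 ≤ Ω) (h1 : Ω ≤ 1) (x : Plane) (u : ℂ) (p : Fin 2 → ℂ) :
    (1 - Ω) / 2 * (‖x‖ ^ 2 * ‖u‖ ^ 2) ≤ formDensity Ω x u p := by
  have e : formDensity Ω x u p
      = (1 - Ω) / 2 * (‖p 0‖ ^ 2 + ‖p 1‖ ^ 2 + ‖x‖ ^ 2 * ‖u‖ ^ 2) + Ω * formDensity 1 x u p := by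
    simp only [formDensity]
    ring
  have hn := mul_nonneg h0 (formDensity_nonneg zero_le_one le_rfl x u p)
  have hp : 0 ≤ (1 - Ω) / 2 * (‖p 0‖ ^ 2 + ‖p 1‖ ^ 2) :=
    mul_nonneg (by linarith) (by positivity)
  rw [e]
  linarith

theorem exists_gradient_position {Ω : ℝ} (h0 : 0 ≤ Ω) (h1 : Ω < 1) {ψ : L2}
    (hψ : omegaNormSq Ω ψ < ⊤) : ∃ G X, IsGradient ψ G ∧ IsPosition ψ X := by
  simp only [omegaNormSq, iInf_lt_iff] at hψ
  obtain ⟨G, hG, hfin⟩ := hψ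
  have hm : ∀ i : Fin 2, MemLp (fun x : Plane => (x i : ℂ) * ψ x) 2 volume := by
    intro i
    have hmeas : AEStronglyMeasurable (fun x : Plane => (x i : ℂ) * ψ x) volume := by
      refine AEStronglyMeasurable.mul ?_ (Lp.aestronglyMeasurable ψ)
      exact Continuous.aestronglyMeasurable (by fun_prop)
    rw [memLp_two_iff_integrable_sq_norm hmeas]
    refine ⟨(hmeas.norm.pow 2), ?_⟩
    rw [hasFiniteIntegral_iff_ofReal (.of_forall fun x => sq_nonneg _)]
    refine lt_of_le_of_lt (b := ENNReal.ofReal (2 / (1 - Ω)) *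
      ∫⁻ x, ENNReal.ofReal (formDensity Ω x (ψ x) fun i => G i x)) ?_
      (ENNReal.mul_lt_top ENNReal.ofReal_lt_top hfin)
    rw [← lintegral_const_mul' _ _ ENNReal.ofReal_ne_top]
    refine lintegral_mono fun x => ?_
    have hpos : 0 < 2 / (1 - Ω) := div_pos two_pos (by linarith)
    rw [← ENNReal.ofReal_mul hpos.le]
    refine ENNReal.ofReal_le_ofReal ?_
    have hge := le_formDensity h0 h1.le x (ψ x) fun i => G i x
    rw [norm_mul, mul_pow, Complex.norm_real, Real.norm_eq_abs, sq_abs, div_mul_eq_mul_div,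
      le_div_iff₀ (by linarith)]
    have hx : x i ^ 2 ≤ ‖x‖ ^ 2 := by
      rw [plane_norm_sq]
      fin_cases i
      · exact le_add_of_nonneg_right (sq_nonneg _)
      · exact le_add_of_nonneg_left (sq_nonneg _)
    have := mul_le_mul_of_nonneg_right hx (sq_nonneg ‖ψ x‖)
    nlinarith
  exact ⟨G, fun i => (hm i).toLp _, hG, fun i => (hm i).coeFn_toLp⟩

/-! ### Scaling and minimizers -/

theorem IsGradient.smul {ψ : L2} {G : Fin 2 → L2} (hG : IsGradient ψ G) (c : ℂ) :
    IsGradient (c • ψ) (c • G) := by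
  refine .of_integral_mul_eq fun i S => ?_
  have hs : ∀ (f : L2) (S : 𝓢(Plane, ℂ)), ∫ x, S x * (c • f : L2) x = c * ∫ x, S x * f x := by
    intro f S
    rw [← integral_const_mul]
    refine integral_congr_ae ?_
    filter_upwards [Lp.coeFn_smul c f] with x hx
    rw [hx, Pi.smul_apply, smul_eq_mul]
    ring
  rw [Pi.smul_apply, hs, hs, hG.integral_mul_eq, mul_neg]

theorem IsPosition.smul {ψ : L2} {X : Fin 2 → L2} (hX : IsPosition ψ X) (c : ℂ) :
    IsPosition (c • ψ) (c • X) := by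
  intro i
  filter_upwards [hX i, Lp.coeFn_smul c ψ, Lp.coeFn_smul c (X i)] with x h1 h2 h3
  rw [Pi.smul_apply, h3, h2, Pi.smul_apply, Pi.smul_apply, h1, smul_eq_mul, smul_eq_mul]
  ring

theorem energy_smul (Ω t : ℝ) (G X : Fin 2 → L2) :
    energy Ω ((t : ℂ) • G) ((t : ℂ) • X) = t ^ 2 * energy Ω G X := by
  simp only [energy, Pi.smul_apply, norm_smul, inner_smul_left, inner_smul_right,
    Complex.conj_ofReal, Complex.im_ofReal_mul, Complex.norm_real, Real.norm_eq_abs, mul_pow, sq_abs]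
  ring

theorem lintegral_enorm_pow_smul (t : ℝ) (ψ : L2) :
    ∫⁻ x, ‖((t : ℂ) • ψ : L2) x‖ₑ ^ 4 = ENNReal.ofReal (t ^ 4) * ∫⁻ x, ‖ψ x‖ₑ ^ 4 := by
  rw [← lintegral_const_mul' _ _ ENNReal.ofReal_ne_top]
  refine lintegral_congr_ae ?_
  filter_upwards [Lp.coeFn_smul (t : ℂ) ψ] with x hx
  rw [hx, Pi.smul_apply, enorm_smul, mul_pow]
  congr 1
  rw [← ofReal_norm, Complex.norm_real, ← ENNReal.ofReal_pow (norm_nonneg _), Real.norm_eq_abs,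
    ← abs_pow, abs_of_nonneg (by positivity)]

/-- The virial inequality for minimizers, obtained by shrinking `ψ` to `t • ψ`. -/
theorem IsAbsoluteMinimizer.energy_le {Ω g lam : ℝ} (h0 : 0 ≤ Ω) (h1 : Ω < 1) {ψ : L2}
    (hψ : IsAbsoluteMinimizer Ω g lam ψ) {G X : Fin 2 → L2} (hG : IsGradient ψ G)
    (hX : IsPosition ψ X) : energy Ω G X ≤ lam * ‖ψ‖ ^ 2 - (‖ψ‖ ^ 2) ^ 2 := by
  obtain ⟨-, hmin⟩ := hψ
  set a := energy Ω G X with ha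
  set n := ‖ψ‖ ^ 2 with hn
  set B := ENNReal.ofReal (g / 2) * ∫⁻ x, ‖ψ x‖ₑ ^ 4 with hB
  have ha0 : 0 ≤ a := energy_nonneg h0 h1.le hG hX
  have hF : ∀ t : ℝ, freeEnergy Ω g lam ((t : ℂ) • ψ) = ENNReal.ofReal (t ^ 2 * a)
      + ENNReal.ofReal (t ^ 4) * B + ENNReal.ofReal ((1 / 2) * (t ^ 2 * n - lam) ^ 2) := by
    intro t
    rw [freeEnergy, omegaNormSq_eq h0 h1.le (hG.smul t) (hX.smul t), energy_smul,
      lintegral_enorm_pow_smul, norm_smul, mul_pow, Complex.norm_real, Real.norm_eq_abs, sq_abs,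
      mul_left_comm]
  have hle : ∀ t : ℝ, freeEnergy Ω g lam ((1 : ℝ) • ψ : L2) ≤ freeEnergy Ω g lam ((t : ℂ) • ψ) := by
    intro t
    rw [one_smul]
    refine hmin _ ?_
    rw [HOmega, Set.mem_ofPred_eq, omegaNormSq_eq h0 h1.le (hG.smul t) (hX.smul t)]
    exact ENNReal.ofReal_lt_top
  have hone : ((1 : ℝ) • ψ : L2) = ((1 : ℝ) : ℂ) • ψ := by simp
  simp only [hone, hF] at hle
  -- At `t = 0` the quartic term is `0 * B`, which is `0` even for `B = ⊤`, so the minimum is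
  -- finite.
  have hBtop : B ≠ ⊤ := by
    have h := hle 0
    intro hB
    simp [hB, ENNReal.mul_eq_top] at h
  obtain ⟨b, hb0, hb⟩ : ∃ b : ℝ, 0 ≤ b ∧ B = ENNReal.ofReal b :=
    ⟨B.toReal, ENNReal.toReal_nonneg, (ENNReal.ofReal_toReal hBtop).symm⟩
  have hreal : ∀ t : ℝ, a + b + (1 / 2) * (n - lam) ^ 2
      ≤ t ^ 2 * a + t ^ 4 * b + (1 / 2) * (t ^ 2 * n - lam) ^ 2 := by
    intro t
    have h := hle t
    rw [hb, ← ENNReal.ofReal_mul (by positivity), ← ENNReal.ofReal_mul (by positivity),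
      ← ENNReal.ofReal_add (by positivity) (by positivity),
      ← ENNReal.ofReal_add (by positivity) (by positivity),
      ← ENNReal.ofReal_add (by positivity) (by positivity),
      ← ENNReal.ofReal_add (by positivity) (by positivity),
      ENNReal.ofReal_le_ofReal_iff (by positivity)] at h
    linarith
  -- With `t ^ 2 = 1 - ε` the comparison is quadratic in `ε`; dividing by `ε` leaves the first
  -- variation on the left.
  have heps : ∀ ε : ℝ, 0 < ε → ε ≤ 1 → a + 2 * b + (n - lam) * n ≤ ε * (b + n ^ 2 / 2) := by
    intro ε he he1
    have h := hreal (Real.sqrt (1 - ε))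
    have e2 : Real.sqrt (1 - ε) ^ 2 = 1 - ε := Real.sq_sqrt (by linarith)
    have e4 : Real.sqrt (1 - ε) ^ 4 = (1 - ε) ^ 2 := by
      rw [show (4 : ℕ) = 2 * 2 from rfl, pow_mul, e2]
    rw [e2, e4] at h
    refine le_of_mul_le_mul_left ?_ he
    nlinarith
  have hlim : Tendsto (fun ε : ℝ => ε * (b + n ^ 2 / 2)) (𝓝[>] 0) (𝓝 0) := by
    have : Tendsto (fun ε : ℝ => ε * (b + n ^ 2 / 2)) (𝓝 0) (𝓝 (0 * (b + n ^ 2 / 2))) :=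
      (continuous_id.mul continuous_const).tendsto 0
    rw [zero_mul] at this
    exact this.mono_left nhdsWithin_le_nhds
  have hfin := ge_of_tendsto hlim (by
    filter_upwards [Ioc_mem_nhdsGT (zero_lt_one (α := ℝ))] with ε he using heps ε he.1 he.2)
  nlinarith

/-- With `n = ‖ψ‖ ^ 2`, the upper and lower bounds on the energy give `n * (n + 1 - lam) ≤ 0`. For
`0 < lam < 1` this yields `ψ = 0`, while `UBar` is empty, whence the condition on `lam`. -/
theorem IsAbsoluteMinimizer.mem_UBar {Ω g lam : ℝ} (h0 : 0 ≤ Ω) (h1 : Ω < 1)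
    (hlam : lam ≤ 0 ∨ 1 ≤ lam) {ψ : L2} (hψ : IsAbsoluteMinimizer Ω g lam ψ) :
    ψ ∈ UBar Ω lam := by
  obtain ⟨G, X, hG, hX⟩ := exists_gradient_position h0 h1 hψ.1
  have hE := hψ.energy_le h0 h1 hG hX
  have hn := norm_sq_le_energy h0 h1.le hG hX
  refine ⟨hψ.1, ?_, ?_⟩
  · rw [omegaNormSq_eq h0 h1.le hG hX, ENNReal.toReal_ofReal (energy_nonneg h0 h1.le hG hX)]
    nlinarith
  · rcases hlam with hl | hl
    · nlinarith [sq_nonneg ‖ψ‖]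
    · refine mul_le_mul_of_nonneg_left ?_ (by linarith)
      rcases (sq_nonneg ‖ψ‖).eq_or_lt with h | h
      · linarith
      · nlinarith

/-! ### A compactness criterion in `L²` -/

theorem enorm_sq_eq_lintegral (f : L2) : ‖f‖ₑ ^ 2 = ∫⁻ x, ‖f x‖ₑ ^ 2 := by
  have h := eLpNorm_nnreal_pow_eq_lintegral (f := (f : Plane → ℂ)) (μ := volume) (p := 2)
    two_ne_zero
  rw [Lp.enorm_def]
  simpa using h

/-- The uniform probability measure on a ball of the plane. -/
def uniformBall (r : ℝ) : Measure Plane := ProbabilityTheory.cond volume (Metric.closedBall 0 r)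

theorem isProbabilityMeasure_uniformBall {r : ℝ} (hr : 0 < r) :
    IsProbabilityMeasure (uniformBall r) :=
  ProbabilityTheory.cond_isProbabilityMeasure_of_finite
    (Metric.measure_closedBall_pos volume 0 hr).ne' measure_closedBall_lt_top.ne

theorem integrable_uniformBall {r : ℝ} (hr : 0 < r) (f : L2) : Integrable f (uniformBall r) := by
  have h1 : IntegrableOn f (Metric.closedBall 0 r) volume :=
    ((Lp.memLp f).locallyIntegrable (by norm_num)).integrableOn_isCompact
      (isCompact_closedBall 0 r)
  exact h1.smul_measure (ENNReal.inv_ne_top.2 (Metric.measure_closedBall_pos volume 0 hr).ne')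

theorem uniformBall_absolutelyContinuous (r : ℝ) : uniformBall r ≪ volume :=
  ProbabilityTheory.cond_absolutelyContinuous

/-- The mean of `f` over the ball of radius `r` about `x`. -/
def ballMean (r : ℝ) (f : L2) (x : Plane) : ℂ := ∫ h, f (h + x) ∂(uniformBall r)

theorem ballMean_eq_integral_translate (r : ℝ) (f : L2) (x : Plane) :
    ballMean r f x = ∫ h, translate x f h ∂(uniformBall r) :=
  integral_congr_ae ((uniformBall_absolutelyContinuous r).ae_le (coeFn_translate x f).symm)

/-- Makes ball means weakly continuous at each point and bounded uniformly in `x` by `‖w‖ * ‖f‖`. -/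
theorem exists_ballMean_eq_inner (r : ℝ) :
    ∃ w : L2, ∀ f x, ballMean r f x = ⟪translate (-x) w, f⟫_ℂ := by
  refine ⟨((volume (Metric.closedBall (0 : Plane) r)).toReal⁻¹ : ℂ) •
    indicatorConstLp 2 (measurableSet_closedBall (x := (0 : Plane)) (ε := r))
      measure_closedBall_lt_top.ne (1 : ℂ), fun f x => ?_⟩
  rw [inner_translate_left, neg_neg, inner_smul_left, L2.inner_indicatorConstLp_one,
    ballMean_eq_integral_translate, uniformBall, ProbabilityTheory.cond, integral_smul_measure]
  simp

theorem stronglyMeasurable_ballMean {r : ℝ} (hr : 0 < r) (f : L2) :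
    StronglyMeasurable (ballMean r f) := by
  have := isProbabilityMeasure_uniformBall hr
  refine StronglyMeasurable.integral_prod_right (f := fun (x h : Plane) => f (h + x)) ?_
  exact (Lp.stronglyMeasurable f).comp_measurable (by fun_prop)

theorem ennreal_add_sq_le (a b : ℝ≥0∞) : (a + b) ^ 2 ≤ 2 * (a ^ 2 + b ^ 2) := by
  have h := ENNReal.rpow_add_le_mul_rpow_add_rpow a b (p := 2) (by norm_num)
  rw [show (2 : ℝ) - 1 = 1 by norm_num] at h
  simpa using h

/-- Split `f x` into its mean and the mean deviation; the square of the latter is bounded by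
Jensen's inequality. -/
theorem enorm_sq_le_ballMean {r : ℝ} (hr : 0 < r) (f : L2) (x : Plane) :
    ‖f x‖ₑ ^ 2 ≤ 2 * ((∫⁻ h, ‖f (h + x) - f x‖ₑ ^ 2 ∂(uniformBall r))
      + ‖ballMean r f x‖ₑ ^ 2) := by
  have := isProbabilityMeasure_uniformBall hr
  have hint : Integrable (fun h => f (h + x)) (uniformBall r) :=
    (integrable_uniformBall hr (translate x f)).congr
      ((uniformBall_absolutelyContinuous r).ae_le (coeFn_translate x f))
  have e : f x = ballMean r f x - ∫ h, (f (h + x) - f x) ∂(uniformBall r) := by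
    rw [integral_sub hint (integrable_const _), integral_const, probReal_univ, one_smul, ballMean]
    ring
  have hJ : ‖∫ h, (f (h + x) - f x) ∂(uniformBall r)‖ₑ ^ 2
      ≤ ∫⁻ h, ‖f (h + x) - f x‖ₑ ^ 2 ∂(uniformBall r) := by
    have h1 : ‖∫ h, (f (h + x) - f x) ∂(uniformBall r)‖ₑ
        ≤ eLpNorm (fun h => f (h + x) - f x) 2 (uniformBall r) := by
      refine (enorm_integral_le_lintegral_enorm _).trans ?_
      rw [← eLpNorm_one_eq_lintegral_enorm]
      exact eLpNorm_le_eLpNorm_of_exponent_le (by norm_num)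
        (hint.sub (integrable_const _)).aestronglyMeasurable
    have h2 := eLpNorm_nnreal_pow_eq_lintegral (f := fun h => f (h + x) - f x)
      (μ := uniformBall r) (p := 2) two_ne_zero
    refine (pow_le_pow_left₀ zero_le h1 2).trans_eq ?_
    simpa using h2
  calc ‖f x‖ₑ ^ 2
      ≤ (‖ballMean r f x‖ₑ + ‖∫ h, (f (h + x) - f x) ∂(uniformBall r)‖ₑ) ^ 2 := by
        refine pow_le_pow_left₀ zero_le ?_ 2
        conv_lhs => rw [e]
        exact enorm_sub_le
    _ ≤ 2 * (‖ballMean r f x‖ₑ ^ 2 + ‖∫ h, (f (h + x) - f x) ∂(uniformBall r)‖ₑ ^ 2) :=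
        ennreal_add_sq_le _ _
    _ ≤ _ := by
        rw [add_comm]
        gcongr

/-- After Tonelli, the integral over `x` is `‖translate h f - f‖ ^ 2` with `‖h‖ ≤ r`. -/
theorem lintegral_lintegral_translate_sub_le {r C : ℝ} (hr : 0 < r) (f : L2)
    (htr : ∀ h, ‖translate h f - f‖ ≤ C * ‖h‖) (hC : 0 ≤ C) :
    ∫⁻ x, ∫⁻ h, ‖f (h + x) - f x‖ₑ ^ 2 ∂(uniformBall r) ≤ ENNReal.ofReal (C * r) ^ 2 := by
  have := isProbabilityMeasure_uniformBall hr
  have hf := (Lp.stronglyMeasurable f).measurable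
  rw [lintegral_lintegral_swap]
  · have hle : ∀ᵐ h ∂(uniformBall r),
        ∫⁻ x, ‖f (h + x) - f x‖ₑ ^ 2 ≤ ENNReal.ofReal (C * r) ^ 2 := by
      filter_upwards [ProbabilityTheory.ae_cond_mem (μ := (volume : Measure Plane))
        (measurableSet_closedBall (x := (0 : Plane)) (ε := r))] with h hh
      have e : ∫⁻ x, ‖f (h + x) - f x‖ₑ ^ 2 = ‖translate h f - f‖ₑ ^ 2 := by
        rw [enorm_sq_eq_lintegral]
        refine lintegral_congr_ae ?_
        filter_upwards [coeFn_translate h f, Lp.coeFn_sub (translate h f) f] with x h1 h2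
        rw [h2, Pi.sub_apply, h1, add_comm]
      rw [e, ← ofReal_norm]
      refine pow_le_pow_left₀ zero_le (ENNReal.ofReal_le_ofReal ((htr h).trans ?_)) 2
      exact mul_le_mul_of_nonneg_left (by simpa using hh) hC
    refine (lintegral_mono_ae hle).trans_eq ?_
    simp
  · refine Measurable.aemeasurable ?_
    have h1 : Measurable fun z : Plane × Plane => f (z.2 + z.1) := hf.comp (by fun_prop)
    have h2 : Measurable fun z : Plane × Plane => f z.1 := hf.comp measurable_fst
    exact ((h1.sub h2).enorm).pow_const 2

/-- One parameter sets both the averaging radius `δ` and the cutoff radius `δ⁻¹`. Inside the cutoff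
the deviation costs `2 * (C * δ) ^ 2`; outside, `1 ≤ δ * ‖x‖` and the moment bound cost `(C * δ) ^
2`. -/
theorem enorm_sq_le_of_translate_of_moment {δ C : ℝ} (hδ : 0 < δ) (hC : 0 ≤ C) (f : L2)
    (htr : ∀ h, ‖translate h f - f‖ ≤ C * ‖h‖)
    (hmom : ∫⁻ x : Plane, ‖x‖ₑ ^ 2 * ‖f x‖ₑ ^ 2 ≤ ENNReal.ofReal C ^ 2) :
    ‖f‖ₑ ^ 2 ≤ ENNReal.ofReal (3 * C ^ 2 * δ ^ 2)
      + 2 * ∫⁻ x in Metric.closedBall (0 : Plane) δ⁻¹, ‖ballMean δ f x‖ₑ ^ 2 := by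
  set A := Metric.closedBall (0 : Plane) δ⁻¹ with hA
  have hmeas : Measurable fun x => ‖ballMean δ f x‖ₑ ^ 2 :=
    ((stronglyMeasurable_ballMean hδ f).measurable.enorm).pow_const 2
  have hin : ∫⁻ x in A, ‖f x‖ₑ ^ 2 ≤ 2 * (ENNReal.ofReal (C * δ) ^ 2)
      + 2 * ∫⁻ x in A, ‖ballMean δ f x‖ₑ ^ 2 := by
    refine (lintegral_mono (enorm_sq_le_ballMean hδ f)).trans ?_
    rw [lintegral_const_mul' _ _ (by norm_num), lintegral_add_right _ hmeas, mul_add]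
    gcongr
    exact (setLIntegral_le_lintegral _ _).trans
      (lintegral_lintegral_translate_sub_le hδ f htr hC)
  have hout : ∫⁻ x in Aᶜ, ‖f x‖ₑ ^ 2 ≤ ENNReal.ofReal (C * δ) ^ 2 := by
    have hle : ∀ x ∈ Aᶜ, ‖f x‖ₑ ^ 2 ≤ ENNReal.ofReal δ ^ 2 * (‖x‖ₑ ^ 2 * ‖f x‖ₑ ^ 2) := by
      intro x hx
      have hx' : δ⁻¹ < ‖x‖ := by simpa [hA] using hx
      have h1 : 1 ≤ δ * ‖x‖ := by
        rw [inv_lt_iff_one_lt_mul₀ hδ] at hx'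
        linarith
      have h2 : (1 : ℝ≥0∞) ≤ ENNReal.ofReal δ * ‖x‖ₑ := by
        rw [← ofReal_norm, ← ENNReal.ofReal_mul hδ.le, ← ENNReal.ofReal_one]
        exact ENNReal.ofReal_le_ofReal h1
      rw [← mul_assoc, ← mul_pow]
      exact le_mul_of_one_le_left zero_le (one_le_pow₀ h2)
    refine (setLIntegral_mono' measurableSet_closedBall.compl hle).trans ?_
    rw [lintegral_const_mul' _ _ (by finiteness), mul_comm C, ENNReal.ofReal_mul hδ.le, mul_pow]
    gcongr
    exact (setLIntegral_le_lintegral _ _).trans hmom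
  rw [enorm_sq_eq_lintegral, ← lintegral_add_compl _ (measurableSet_closedBall : MeasurableSet A)]
  refine (add_le_add hin hout).trans_eq ?_
  rw [show 3 * C ^ 2 * δ ^ 2 = 3 * (C * δ) ^ 2 by ring,
    ENNReal.ofReal_mul (p := 3) (by norm_num),
    ENNReal.ofReal_pow (by positivity)]
  norm_num
  ring

/-- A weakly null sequence with bounded moments, whose translations are uniformly Lipschitz,
converges strongly. -/
theorem tendsto_zero_of_weak {f : ℕ → L2} {C : ℝ} (hC : 0 ≤ C)
    (hw : ∀ w : L2, Tendsto (fun n => ⟪w, f n⟫_ℂ) atTop (𝓝 0)) (hb : ∀ n, ‖f n‖ ≤ C)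
    (htr : ∀ n h, ‖translate h (f n) - f n‖ ≤ C * ‖h‖)
    (hmom : ∀ n, ∫⁻ x : Plane, ‖x‖ₑ ^ 2 * ‖f n x‖ₑ ^ 2 ≤ ENNReal.ofReal C ^ 2) :
    Tendsto f atTop (𝓝 0) := by
  have hmean : ∀ δ : ℝ, 0 < δ → Tendsto (fun n => 2 *
      ∫⁻ x in Metric.closedBall (0 : Plane) δ⁻¹, ‖ballMean δ (f n) x‖ₑ ^ 2) atTop (𝓝 0) := by
    intro δ hδ
    obtain ⟨w, hwm⟩ := exists_ballMean_eq_inner δ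
    have hlim := tendsto_lintegral_of_dominated_convergence
      (μ := volume.restrict (Metric.closedBall (0 : Plane) δ⁻¹))
      (F := fun n x => ‖ballMean δ (f n) x‖ₑ ^ 2) (f := fun _ => 0)
      (fun _ => ENNReal.ofReal (‖w‖ * C) ^ 2)
      (fun n => ((stronglyMeasurable_ballMean hδ (f n)).measurable.enorm).pow_const 2)
      (fun n => .of_forall fun x => by
        simp only [hwm]
        rw [← ofReal_norm]
        refine pow_le_pow_left₀ zero_le (ENNReal.ofReal_le_ofReal ?_) 2
        refine (norm_inner_le_norm _ _).trans ?_
        rw [LinearIsometry.norm_map]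
        exact mul_le_mul_of_nonneg_left (hb n) (norm_nonneg _))
      (by
        rw [setLIntegral_const]
        exact ENNReal.mul_ne_top (by finiteness) measure_closedBall_lt_top.ne)
      (.of_forall fun x => by
        simp only [hwm]
        have h := (ENNReal.continuous_pow 2).tendsto _ |>.comp (hw (translate (-x) w)).enorm
        simpa [Function.comp_def] using h)
    rw [lintegral_zero] at hlim
    simpa using ENNReal.Tendsto.const_mul hlim (Or.inr (by norm_num : (2 : ℝ≥0∞) ≠ ⊤))
  rw [Metric.tendsto_nhds]
  intro ε hε
  -- This makes `3 * C ^ 2 * δ ^ 2` less than `ε ^ 2 / 3`, leaving room for the local means.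
  set δ := ε / (3 * (C + 1)) with hδ
  have hδ0 : 0 < δ := by positivity
  have hCδ : 3 * C ^ 2 * δ ^ 2 < ε ^ 2 / 2 := by
    have h1 : δ * (3 * (C + 1)) = ε := div_mul_cancel₀ _ (by positivity)
    have h2 : 0 < δ ^ 2 := by positivity
    have h3 : ε ^ 2 = δ ^ 2 * (9 * (C + 1) ^ 2) := by rw [← h1]; ring
    rw [h3]
    nlinarith
  have hev := (ENNReal.tendsto_nhds_zero.1 (hmean δ hδ0)) (ENNReal.ofReal (ε ^ 2 / 2))
    (ENNReal.ofReal_pos.2 (by positivity))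
  filter_upwards [hev] with n hn
  have h1 := (enorm_sq_le_of_translate_of_moment hδ0 hC (f n) (htr n) (hmom n)).trans
    (add_le_add le_rfl hn)
  rw [← ENNReal.ofReal_add (by positivity) (by positivity), ← ofReal_norm,
    ← ENNReal.ofReal_pow (norm_nonneg _), ENNReal.ofReal_le_ofReal_iff (by positivity)] at h1
  rw [dist_zero_right]
  exact lt_of_pow_lt_pow_left₀ 2 hε.le (by linarith)

/-! ### Weak limits -/

/-- Sequential Banach–Alaoglu in the dual of the separable space `L2`, carried back by the Riesz
isomorphism. -/
theorem exists_weak_limit_of_bounded {u : ℕ → L2} {C : ℝ} (hu : ∀ n, ‖u n‖ ≤ C) :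
    ∃ v : L2, ∃ φ : ℕ → ℕ, StrictMono φ ∧
      ∀ w : L2, Tendsto (fun n => ⟪w, u (φ n)⟫_ℂ) atTop (𝓝 ⟪w, v⟫_ℂ) := by
  have : Fact ((2 : ℝ≥0∞) ≠ ⊤) := ⟨by norm_num⟩
  let T : L2 → WeakDual ℂ L2 := fun x => StrongDual.toWeakDual (InnerProductSpace.toDual ℂ L2 x)
  have hT : ∀ n, T (u n) ∈ WeakDual.toStrongDual ⁻¹' Metric.closedBall (0 : StrongDual ℂ L2) C := by
    intro n
    rw [Set.mem_preimage, mem_closedBall_zero_iff]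
    exact ((InnerProductSpace.toDual ℂ L2).norm_map (u n)).trans_le (hu n)
  obtain ⟨ℓ, -, φ, hφ, hlim⟩ := WeakDual.isSeqCompact_closedBall ℂ L2 0 C hT
  refine ⟨(InnerProductSpace.toDual ℂ L2).symm (WeakDual.toStrongDual ℓ), φ, hφ, fun w => ?_⟩
  have h : Tendsto (fun n => T (u (φ n)) w) atTop (𝓝 (ℓ w)) :=
    ((WeakDual.eval_continuous w).tendsto ℓ).comp hlim
  have h2 := (Complex.continuous_conj.tendsto _).comp h
  have e1 : ∀ n, (starRingEnd ℂ) (T (u (φ n)) w) = ⟪w, u (φ n)⟫_ℂ := fun n =>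
    inner_conj_symm (𝕜 := ℂ) w (u (φ n))
  have e2 : (starRingEnd ℂ) (ℓ w)
      = ⟪w, (InnerProductSpace.toDual ℂ L2).symm (WeakDual.toStrongDual ℓ)⟫_ℂ := by
    rw [← inner_conj_symm, InnerProductSpace.toDual_symm_apply]
    rfl
  rw [← e2]
  exact h2.congr e1

theorem exists_weak_limit_of_bounded_fin (m : ℕ) {u : Fin m → ℕ → L2} {C : ℝ}
    (hu : ∀ i n, ‖u i n‖ ≤ C) :
    ∃ φ : ℕ → ℕ, StrictMono φ ∧ ∀ i, ∃ v : L2,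
      ∀ w : L2, Tendsto (fun n => ⟪w, u i (φ n)⟫_ℂ) atTop (𝓝 ⟪w, v⟫_ℂ) := by
  induction m with
  | zero => exact ⟨id, strictMono_id, fun i => i.elim0⟩
  | succ m ih =>
    obtain ⟨φ, hφ, h⟩ := ih (u := fun i => u i.succ) fun i n => hu i.succ n
    obtain ⟨v, χ, hχ, h0⟩ := exists_weak_limit_of_bounded (u := fun n => u 0 (φ n))
      fun n => hu 0 (φ n)
    refine ⟨φ ∘ χ, hφ.comp hχ, Fin.cases ⟨v, h0⟩ fun i => ?_⟩
    obtain ⟨v', hv'⟩ := h i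
    exact ⟨v', fun w => (hv' w).comp hχ.tendsto_atTop⟩

theorem exists_inner_eq_integral_mul (S : 𝓢(Plane, ℂ)) :
    ∃ Φ : L2, ∀ f : L2, ⟪Φ, f⟫_ℂ = ∫ x, S x * f x := by
  have hS : MemLp (fun x => (starRingEnd ℂ) (S x)) 2 (volume : Measure Plane) :=
    (S.memLp 2 volume).of_le
      (Complex.continuous_conj.comp S.continuous).aestronglyMeasurable
      (.of_forall fun x => (RCLike.norm_conj (S x)).le)
  refine ⟨hS.toLp _, fun f => ?_⟩
  rw [L2.inner_def]
  refine integral_congr_ae ?_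
  filter_upwards [hS.coeFn_toLp] with x hx
  rw [hx, RCLike.inner_apply, RCLike.conj_conj, mul_comm]

theorem tendsto_integral_mul {u : ℕ → L2} {v : L2}
    (h : ∀ w : L2, Tendsto (fun n => ⟪w, u n⟫_ℂ) atTop (𝓝 ⟪w, v⟫_ℂ)) (S : 𝓢(Plane, ℂ)) :
    Tendsto (fun n => ∫ x, S x * u n x) atTop (𝓝 (∫ x, S x * v x)) := by
  obtain ⟨Φ, hΦ⟩ := exists_inner_eq_integral_mul S
  simpa only [hΦ] using h Φ

theorem IsGradient.of_weak_limit {ψ : ℕ → L2} {G : ℕ → Fin 2 → L2} {ψ' : L2} {G' : Fin 2 → L2}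
    (hG : ∀ n, IsGradient (ψ n) (G n))
    (hψ' : ∀ w : L2, Tendsto (fun n => ⟪w, ψ n⟫_ℂ) atTop (𝓝 ⟪w, ψ'⟫_ℂ))
    (hG' : ∀ (i) (w : L2), Tendsto (fun n => ⟪w, G n i⟫_ℂ) atTop (𝓝 ⟪w, G' i⟫_ℂ)) :
    IsGradient ψ' G' := by
  refine .of_integral_mul_eq fun i S => ?_
  refine tendsto_nhds_unique (tendsto_integral_mul (hG' i) S)
    (((tendsto_integral_mul hψ' (∂_{dir i} S)).neg).congr fun n => ?_)
  exact ((hG n).integral_mul_eq i S).symm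

/-- The unbounded factor `x i` is moved onto a compactly supported test function, where it is
harmless. -/
theorem IsPosition.of_weak_limit {ψ : ℕ → L2} {X : ℕ → Fin 2 → L2} {ψ' : L2} {X' : Fin 2 → L2}
    (hX : ∀ n, IsPosition (ψ n) (X n))
    (hψ' : ∀ w : L2, Tendsto (fun n => ⟪w, ψ n⟫_ℂ) atTop (𝓝 ⟪w, ψ'⟫_ℂ))
    (hX' : ∀ (i) (w : L2), Tendsto (fun n => ⟪w, X n i⟫_ℂ) atTop (𝓝 ⟪w, X' i⟫_ℂ)) :
    IsPosition ψ' X' := by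
  intro i
  have hloc : ∀ f : L2, LocallyIntegrable (f : Plane → ℂ) volume :=
    fun f => (Lp.memLp f).locallyIntegrable (by norm_num)
  have hcoord : Continuous fun x : Plane => (x i : ℂ) := by fun_prop
  have hloc2 : LocallyIntegrable (fun x : Plane => (x i : ℂ) * ψ' x) volume := by
    have := (hloc ψ').locallyIntegrableOn Set.univ
    rw [← locallyIntegrableOn_univ]
    exact this.continuousOn_mul hcoord.continuousOn isOpen_univ.isLocallyClosed
  refine ae_eq_of_integral_contDiff_smul_eq (hloc (X' i)) hloc2 fun g hg hgc => ?_
  have hc1 : HasCompactSupport fun x => (g x : ℂ) := hgc.comp_left Complex.ofReal_zero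
  have hs1 : ContDiff ℝ ∞ fun x => (g x : ℂ) := Complex.ofRealCLM.contDiff.comp hg
  have hc2 : HasCompactSupport fun x : Plane => (g x : ℂ) * (x i : ℂ) := hc1.mul_right
  have hx : ContDiff ℝ ∞ fun x : Plane => (x i : ℂ) :=
    Complex.ofRealCLM.contDiff.comp (EuclideanSpace.proj (𝕜 := ℝ) i).contDiff
  have hs2 : ContDiff ℝ ∞ fun x : Plane => (g x : ℂ) * (x i : ℂ) := hs1.mul hx
  have h1 := tendsto_integral_mul (hX' i) (hc1.toSchwartzMap hs1)
  have h2 := tendsto_integral_mul hψ' (hc2.toSchwartzMap hs2)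
  have h3 := tendsto_nhds_unique h1 (h2.congr fun n => ?_)
  · calc ∫ x, g x • X' i x = ∫ x, (hc1.toSchwartzMap hs1) x * X' i x := by
          simp [Complex.real_smul]
      _ = ∫ x, (hc2.toSchwartzMap hs2) x * ψ' x := h3
      _ = ∫ x, g x • ((x i : ℂ) * ψ' x) := by simp [Complex.real_smul, mul_assoc]
  · refine integral_congr_ae ?_
    filter_upwards [hX n i] with x hx
    simp only [HasCompactSupport.toSchwartzMap_toFun, hx, mul_assoc]

/-- The tangent to the squared norm at `v` is weakly continuous, lies below the squared norm and
touches it at `v`; this gives lower semicontinuity without a `liminf`. -/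
theorem tendsto_tangent_norm_sq {u : ℕ → L2} {v : L2}
    (h : ∀ w : L2, Tendsto (fun n => ⟪w, u n⟫_ℂ) atTop (𝓝 ⟪w, v⟫_ℂ)) :
    Tendsto (fun n => 2 * (⟪v, u n⟫_ℂ).re - ‖v‖ ^ 2) atTop (𝓝 (‖v‖ ^ 2)) := by
  have h1 := (Complex.continuous_re.tendsto _).comp (h v)
  have e : (⟪v, v⟫_ℂ).re = ‖v‖ ^ 2 := inner_self_eq_norm_sq (𝕜 := ℂ) v
  rw [e] at h1
  have h2 := (h1.const_mul 2).sub_const (‖v‖ ^ 2)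
  rw [show 2 * ‖v‖ ^ 2 - ‖v‖ ^ 2 = ‖v‖ ^ 2 by ring] at h2
  exact h2

theorem tangent_norm_sq_le {E : Type*} [NormedAddCommGroup E] [InnerProductSpace ℂ E] (v u : E) :
    2 * (⟪v, u⟫_ℂ).re - ‖v‖ ^ 2 ≤ ‖u‖ ^ 2 := by
  have h : ‖v - u‖ ^ 2 = ‖v‖ ^ 2 - 2 * (⟪v, u⟫_ℂ).re + ‖u‖ ^ 2 := norm_sub_sq (𝕜 := ℂ) v u
  nlinarith [sq_nonneg ‖v - u‖]

/-- Weak lower semicontinuity of the energy. -/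
theorem energy_le_of_weak_limit {Ω : ℝ} (h0 : 0 ≤ Ω) (h1 : Ω ≤ 1) {G X : ℕ → Fin 2 → L2}
    {G' X' : Fin 2 → L2}
    (hG : ∀ (i) (w : L2), Tendsto (fun n => ⟪w, G n i⟫_ℂ) atTop (𝓝 ⟪w, G' i⟫_ℂ))
    (hX : ∀ (i) (w : L2), Tendsto (fun n => ⟪w, X n i⟫_ℂ) atTop (𝓝 ⟪w, X' i⟫_ℂ))
    {c : ℕ → ℝ} {c' : ℝ} (hle : ∀ n, energy Ω (G n) (X n) ≤ c n)
    (hc : Tendsto c atTop (𝓝 c')) : energy Ω G' X' ≤ c' := by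
  have hcomb : ∀ (i j : Fin 2) (r : ℝ) (w : L2),
      Tendsto (fun n => ⟪w, G n i + ((r : ℝ) * Complex.I : ℂ) • X n j⟫_ℂ) atTop
        (𝓝 ⟪w, G' i + ((r : ℝ) * Complex.I : ℂ) • X' j⟫_ℂ) := by
    intro i j r w
    simp only [inner_add_right, inner_smul_right]
    exact (hG i w).add ((hX j w).const_mul _)
  have hΩ : 0 ≤ 1 - Ω ^ 2 := by nlinarith
  have hlim := (((tendsto_tangent_norm_sq (hcomb 0 1 (-Ω))).add
    (tendsto_tangent_norm_sq (hcomb 1 0 Ω))).add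
    (((tendsto_tangent_norm_sq (hX 0)).add (tendsto_tangent_norm_sq (hX 1))).const_mul
      (1 - Ω ^ 2))).const_mul (1 / 2)
  rw [← energy_eq_sum_sq] at hlim
  refine le_of_tendsto_of_tendsto' hlim hc fun n => le_trans ?_ (hle n)
  rw [energy_eq_sum_sq]
  gcongr <;> exact tangent_norm_sq_le _ _

/-! ### From weak to strong convergence under gradient and moment bounds -/

theorem IsGradient.sub {ψ φ : L2} {G H : Fin 2 → L2} (hG : IsGradient ψ G)
    (hH : IsGradient φ H) : IsGradient (ψ - φ) (G - H) := by
  refine .of_integral_mul_eq fun i S => ?_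
  have hs : ∀ (f g : L2) (S : 𝓢(Plane, ℂ)),
      ∫ x, S x * (f - g : L2) x = (∫ x, S x * f x) - ∫ x, S x * g x := by
    intro f g S
    obtain ⟨Φ, hΦ⟩ := exists_inner_eq_integral_mul S
    simp only [← hΦ, inner_sub_right]
  rw [Pi.sub_apply, hs, hs, hG.integral_mul_eq, hH.integral_mul_eq]
  ring

theorem IsPosition.sub {ψ φ : L2} {X Y : Fin 2 → L2} (hX : IsPosition ψ X)
    (hY : IsPosition φ Y) : IsPosition (ψ - φ) (X - Y) := by
  intro i
  filter_upwards [hX i, hY i, Lp.coeFn_sub ψ φ, Lp.coeFn_sub (X i) (Y i)] with x h1 h2 h3 h4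
  rw [Pi.sub_apply, h4, h3, Pi.sub_apply, Pi.sub_apply, h1, h2]
  ring

theorem IsGradient.norm_translate_sub_le {ψ : L2} {G : Fin 2 → L2} (hG : IsGradient ψ G)
    (h : Plane) : ‖translate h ψ - ψ‖ ≤ (‖G 0‖ + ‖G 1‖) * ‖h‖ := by
  have hh : h = h 0 • dir 0 + h 1 • dir 1 := by
    ext i
    fin_cases i <;> simp [dir]
  have e : translate h ψ - ψ = translate (h 0 • dir 0) (translate (h 1 • dir 1) ψ - ψ)
      + (translate (h 0 • dir 0) ψ - ψ) := by
    rw [map_sub, translate_translate, ← hh]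
    abel
  have b : ∀ i, |h i| ≤ ‖h‖ := fun i => PiLp.norm_apply_le h i
  rw [e]
  refine (norm_add_le _ _).trans ?_
  rw [LinearIsometry.norm_map]
  have h1 := RotatingTrap.norm_translate_sub_le hG 0 (h 0)
  have h2 := RotatingTrap.norm_translate_sub_le hG 1 (h 1)
  have h3 := mul_le_mul_of_nonneg_left (b 0) (norm_nonneg (G 0))
  have h4 := mul_le_mul_of_nonneg_left (b 1) (norm_nonneg (G 1))
  linarith

theorem IsPosition.lintegral_moment {ψ : L2} {X : Fin 2 → L2} (hX : IsPosition ψ X) :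
    ∫⁻ x : Plane, ‖x‖ₑ ^ 2 * ‖ψ x‖ₑ ^ 2 = ‖X 0‖ₑ ^ 2 + ‖X 1‖ₑ ^ 2 := by
  rw [enorm_sq_eq_lintegral, enorm_sq_eq_lintegral, ← lintegral_add_left
    (((Lp.stronglyMeasurable (X 0)).measurable.enorm).pow_const 2)]
  refine lintegral_congr_ae ?_
  filter_upwards [hX 0, hX 1] with x h0 h1
  simp only [h0, h1, ← ofReal_norm]
  rw [← ENNReal.ofReal_pow (norm_nonneg _), ← ENNReal.ofReal_pow (norm_nonneg _),
    ← ENNReal.ofReal_pow (norm_nonneg _), ← ENNReal.ofReal_pow (norm_nonneg _),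
    ← ENNReal.ofReal_mul (sq_nonneg _), ← ENNReal.ofReal_add (sq_nonneg _) (sq_nonneg _),
    plane_norm_sq, norm_mul, norm_mul, mul_pow, mul_pow, Complex.norm_real, Complex.norm_real,
    Real.norm_eq_abs, Real.norm_eq_abs, sq_abs, sq_abs]
  congr 1
  ring

/-- A weakly convergent sequence with bounded gradients and moments converges strongly. -/
theorem tendsto_of_weak_of_bounded {ψ : ℕ → L2} {G X : ℕ → Fin 2 → L2} {ψ' : L2}
    {G' X' : Fin 2 → L2} {K : ℝ} (hG : ∀ n, IsGradient (ψ n) (G n))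
    (hX : ∀ n, IsPosition (ψ n) (X n)) (hG' : IsGradient ψ' G') (hX' : IsPosition ψ' X')
    (hψK : ∀ n, ‖ψ n‖ ≤ K) (hGK : ∀ n i, ‖G n i‖ ≤ K) (hXK : ∀ n i, ‖X n i‖ ≤ K)
    (hw : ∀ w : L2, Tendsto (fun n => ⟪w, ψ n⟫_ℂ) atTop (𝓝 ⟪w, ψ'⟫_ℂ)) :
    Tendsto ψ atTop (𝓝 ψ') := by
  have hK : 0 ≤ K := (norm_nonneg _).trans (hψK 0)
  set K' := ‖ψ'‖ + ‖G' 0‖ + ‖G' 1‖ + ‖X' 0‖ + ‖X' 1‖ with hK'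
  -- Large enough for the norm, the translation constant and the moment of `ψ n - ψ'` alike: each
  -- sum of two component norms is at most `2 * K + K'`.
  set C := 2 * (K + K') with hC
  have p0 := norm_nonneg ψ'
  have p1 := norm_nonneg (G' 0)
  have p2 := norm_nonneg (G' 1)
  have p3 := norm_nonneg (X' 0)
  have p4 := norm_nonneg (X' 1)
  rw [tendsto_iff_norm_sub_tendsto_zero, ← tendsto_zero_iff_norm_tendsto_zero]
  refine tendsto_zero_of_weak (C := C) (by positivity) (fun w => ?_) (fun n => ?_) (fun n h => ?_)
    fun n => ?_
  · have h := (hw w).sub_const ⟪w, ψ'⟫_ℂ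
    rw [sub_self] at h
    simpa only [inner_sub_right] using h
  · have := norm_sub_le (ψ n) ψ'
    linarith [hψK n]
  · refine (((hG n).sub hG').norm_translate_sub_le h).trans
      (mul_le_mul_of_nonneg_right ?_ (norm_nonneg h))
    have h1 := norm_sub_le (G n 0) (G' 0)
    have h2 := norm_sub_le (G n 1) (G' 1)
    simp only [Pi.sub_apply]
    linarith [hGK n 0, hGK n 1]
  · rw [((hX n).sub hX').lintegral_moment, ← ofReal_norm, ← ofReal_norm,
      ← ENNReal.ofReal_pow (norm_nonneg _), ← ENNReal.ofReal_pow (norm_nonneg _),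
      ← ENNReal.ofReal_add (sq_nonneg _) (sq_nonneg _), ← ENNReal.ofReal_pow (by positivity)]
    refine ENNReal.ofReal_le_ofReal ?_
    have h1 := norm_sub_le (X n 0) (X' 0)
    have h2 := norm_sub_le (X n 1) (X' 1)
    have h3 : ‖(X n - X') 0‖ + ‖(X n - X') 1‖ ≤ C := by
      simp only [Pi.sub_apply]
      linarith [hXK n 0, hXK n 1]
    have h4 := pow_le_pow_left₀ (by positivity) h3 2
    nlinarith [norm_nonneg ((X n - X') 0), norm_nonneg ((X n - X') 1),
      mul_nonneg (norm_nonneg ((X n - X') 0)) (norm_nonneg ((X n - X') 1))]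

/-- Coercivity: `energy Ω` is `(1 - Ω)` times `energy 0` plus `Ω` times the nonnegative `energy 1`.
-/
theorem sum_norm_sq_le_energy {Ω : ℝ} (h0 : 0 ≤ Ω) {ψ : L2} {G X : Fin 2 → L2}
    (hG : IsGradient ψ G) (hX : IsPosition ψ X) :
    (1 - Ω) / 2 * (‖G 0‖ ^ 2 + ‖G 1‖ ^ 2 + ‖X 0‖ ^ 2 + ‖X 1‖ ^ 2) ≤ energy Ω G X := by
  have h := mul_nonneg h0 (energy_nonneg zero_le_one le_rfl hG hX)
  simp only [energy] at h ⊢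
  linarith

/-! ### Compactness -/

theorem isCompact_UBar {Ω : ℝ} (lam : ℝ) (h0 : 0 ≤ Ω) (h1 : Ω < 1) :
    IsCompact (UBar Ω lam) := by
  refine IsSeqCompact.isCompact fun ψ hψ => ?_
  choose G X hG hX using fun n => exists_gradient_position h0 h1 (hψ n).1
  have hE : ∀ n, energy Ω (G n) (X n) ≤ lam * ‖ψ n‖ ^ 2 := by
    intro n
    have h := (hψ n).2.1
    rwa [omegaNormSq_eq h0 h1.le (hG n) (hX n),
      ENNReal.toReal_ofReal (energy_nonneg h0 h1.le (hG n) (hX n))] at h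
  set M := lam * (lam - 1) with hM
  have hEM : ∀ n, energy Ω (G n) (X n) ≤ M := fun n => (hE n).trans (hψ n).2.2
  set D := 2 * M / (1 - Ω) with hD
  have hΩ : 0 < 1 - Ω := by linarith
  have hsum : ∀ n, ‖G n 0‖ ^ 2 + ‖G n 1‖ ^ 2 + ‖X n 0‖ ^ 2 + ‖X n 1‖ ^ 2 ≤ D := by
    intro n
    have h := (sum_norm_sq_le_energy h0 (hG n) (hX n)).trans (hEM n)
    rw [hD, le_div_iff₀ hΩ]
    linarith
  -- A common bound for the five sequences, so that one subsequence serves them all.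
  set K := Real.sqrt M + Real.sqrt D with hK
  have hψK : ∀ n, ‖ψ n‖ ≤ K := fun n =>
    (Real.le_sqrt_of_sq_le ((norm_sq_le_energy h0 h1.le (hG n) (hX n)).trans (hEM n))).trans
      (le_add_of_nonneg_right (Real.sqrt_nonneg _))
  have hDK : ∀ x : ℝ, x ^ 2 ≤ D → x ≤ K := fun x hx =>
    (Real.le_sqrt_of_sq_le hx).trans (le_add_of_nonneg_left (Real.sqrt_nonneg _))
  have hGK : ∀ n i, ‖G n i‖ ≤ K := by
    intro n i
    refine hDK _ (le_trans ?_ (hsum n))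
    fin_cases i <;> simp only [Fin.zero_eta, Fin.mk_one] <;>
      linarith [sq_nonneg ‖G n 0‖, sq_nonneg ‖G n 1‖, sq_nonneg ‖X n 0‖, sq_nonneg ‖X n 1‖]
  have hXK : ∀ n i, ‖X n i‖ ≤ K := by
    intro n i
    refine hDK _ (le_trans ?_ (hsum n))
    fin_cases i <;> simp only [Fin.zero_eta, Fin.mk_one] <;>
      linarith [sq_nonneg ‖G n 0‖, sq_nonneg ‖G n 1‖, sq_nonneg ‖X n 0‖, sq_nonneg ‖X n 1‖]
  obtain ⟨φ, hφ, hlim⟩ := exists_weak_limit_of_bounded_fin 5 (C := K)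
    (u := ![ψ, fun n => G n 0, fun n => G n 1, fun n => X n 0, fun n => X n 1])
    (by
      intro i n
      fin_cases i
      exacts [hψK n, hGK n 0, hGK n 1, hXK n 0, hXK n 1])
  obtain ⟨ψ', hψ'⟩ := hlim 0
  obtain ⟨G0, hG0⟩ := hlim 1
  obtain ⟨G1, hG1⟩ := hlim 2
  obtain ⟨X0, hX0⟩ := hlim 3
  obtain ⟨X1, hX1⟩ := hlim 4
  have hGw : ∀ (i) (w : L2),
      Tendsto (fun n => ⟪w, G (φ n) i⟫_ℂ) atTop (𝓝 ⟪w, (![G0, G1] : Fin 2 → L2) i⟫_ℂ) := by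
    intro i
    fin_cases i
    exacts [hG0, hG1]
  have hXw : ∀ (i) (w : L2),
      Tendsto (fun n => ⟪w, X (φ n) i⟫_ℂ) atTop (𝓝 ⟪w, (![X0, X1] : Fin 2 → L2) i⟫_ℂ) := by
    intro i
    fin_cases i
    exacts [hX0, hX1]
  have hG' := IsGradient.of_weak_limit (fun n => hG (φ n)) hψ' hGw
  have hX' := IsPosition.of_weak_limit (fun n => hX (φ n)) hψ' hXw
  have hstrong : Tendsto (fun n => ψ (φ n)) atTop (𝓝 ψ') :=
    tendsto_of_weak_of_bounded (fun n => hG (φ n)) (fun n => hX (φ n)) hG' hX'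
      (fun n => hψK (φ n)) (fun n => hGK (φ n)) (fun n => hXK (φ n)) hψ'
  have hnorm : Tendsto (fun n => lam * ‖ψ (φ n)‖ ^ 2) atTop (𝓝 (lam * ‖ψ'‖ ^ 2)) :=
    (hstrong.norm.pow 2).const_mul lam
  have homega := omegaNormSq_eq h0 h1.le hG' hX'
  refine ⟨ψ', ⟨?_, ?_, ?_⟩, φ, hφ, hstrong⟩
  · rw [homega]
    exact ENNReal.ofReal_lt_top
  · rw [homega, ENNReal.toReal_ofReal (energy_nonneg h0 h1.le hG' hX')]
    exact energy_le_of_weak_limit h0 h1.le hGw hXw (fun n => hE (φ n)) hnorm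
  · exact le_of_tendsto' hnorm fun n => (hψ (φ n)).2.2

end RotatingTrap

end

theorem theorem2 (Ω g lam : ℝ) (hΩ0 : 0 ≤ Ω) (hΩ1 : Ω < 1) (hg : 0 ≤ g) :
    IsCompact (RotatingTrap.UBar Ω lam) ∧
      ((lam ≤ 0 ∨ 1 ≤ lam) → ∀ ψ : RotatingTrap.L2,
        RotatingTrap.IsAbsoluteMinimizer Ω g lam ψ → ψ ∈ RotatingTrap.UBar Ω lam) :=
  ⟨RotatingTrap.isCompact_UBar lam hΩ0 hΩ1, fun hlam _ hψ => hψ.mem_UBar hΩ0 hΩ1 hlam⟩
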